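/- Let $\mathbb D=\{z\in\mathbb C:|z|<1\}$, let $H(\mathbb D)$ be the space of holomorphic functions on $\mathbb D$ with the topology of uniform convergence on compact subsets of $\mathbb D$, let $dA$ be the normalized Lebesgue measure on $\mathbb D$, and for $g\in H(\mathbb D)$ write $g(z)=\sum_{n\ge 0}\hat g(n)z^n$. For $\alpha\in\mathbb R$ put $$\mathfrak B_{\log^\alpha}=\Big\{f\in H(\mathbb D): |f'(z)|=\mathcal O\Big((1-|z|)^{-1}\log^\alpha\frac{2}{1-|z|}\Big)\Big\},$$ $$\mathfrak B^1_{\log^\alpha}=\Big\{f\in H(\mathbb D): \|f\|_{\mathfrak B^1_{\log^\alpha}}=|f(0)|+\int_{\mathbb D}|f'(z)|\log^\alpha\frac{2}{1-|z|}\,dA(z)<\infty\Big\},$$ $$\ell^1_{-1}=\Big\{g\in H(\mathbb D): \sum_{n=0}^\infty\frac{|\hat g(n)|}{n+1}<\infty\Big\},$$ where $\mathfrak B^1_{\log^\alpha}$ carries the topology of its norm. Let $H(\overline{\mathbb D})$ be the set of functions in $H(\mathbb D)$ that extend holomorphically to a neighbourhood of the closed disk, and let the Libera operator be defined on $H(\overline{\mathbb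 D})$ by $\mathcal L f(z)=\int_0^1 f(t+(1-t)z)\,dt$, $z\in\mathbb D$. Let $\alpha\in\mathbb R$. Then: (a) $\mathfrak B_{\log^\alpha}\subset\ell^1_{-1}$ (for every $\alpha$). (b) $\mathfrak B^1_{\log^\alpha}\subset\ell^1_{-1}$ if and only if $\alpha\ge 0$. (c) If $\alpha<0$, then $\mathcal L$ cannot be extended to a continuous operator from $\mathfrak B^1_{\log^\alpha}$ to $H(\mathbb D)$; that is, there is no continuous linear map $T:\mathfrak B^1_{\log^\alpha}\to H(\mathbb D)$ with $Tf=\mathcal L f$ for all $f\in H(\overline{\mathbb D})\cap\mathfrak B^1_{\log^\alpha}$. -/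

import Mathlib

set_option maxSynthPendingDepth 3

open MeasureTheory

noncomputable section

namespace LogBloch

/-- The open unit disk of the complex plane, as a type. -/
abbrev Disk : Type := Metric.ball (0 : ℂ) 1

/-- Extension by zero of a function on the disk to the whole plane; used only to speak of
derivatives and integrals at points of the disk. -/
def extend (f : Disk → ℂ) : ℂ → ℂ := fun z =>
  open Classical in if h : z ∈ Metric.ball (0 : ℂ) 1 then f ⟨z, h⟩ else 0

theorem extend_apply (f : Disk → ℂ) (z : Disk) : extend f z = f z := by
  have h : (z : ℂ) ∈ Metric.ball (0 : ℂ) 1 := z.2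
  simp only [extend, dif_pos h]

theorem extend_add (f g : Disk → ℂ) : extend (f + g) = extend f + extend g := by
  funext z
  by_cases h : z ∈ Metric.ball (0 : ℂ) 1 <;> simp only [extend, h, Pi.add_apply] <;> simp

theorem extend_smul (c : ℂ) (f : Disk → ℂ) : extend (c • f) = c • extend f := by
  funext z
  by_cases h : z ∈ Metric.ball (0 : ℂ) 1 <;> simp only [extend, h, Pi.smul_apply] <;> simp

theorem extend_zero : extend 0 = 0 := by
  funext z
  by_cases h : z ∈ Metric.ball (0 : ℂ) 1 <;> simp only [extend, h] <;> simp

/-- `H(𝔻)`: the holomorphic functions on the unit disk. It is a subspace of the continuous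
functions on the disk with the compact-open topology, so it carries the topology of uniform
convergence on compact subsets of the disk. -/
def Hol : Submodule ℂ C(Disk, ℂ) where
  carrier := {f | DifferentiableOn ℂ (extend f) (Metric.ball 0 1)}
  add_mem' := by
    intro f g hf hg
    simp only [Set.mem_ofPred_eq, ContinuousMap.coe_add, extend_add] at *
    exact hf.add hg
  zero_mem' := by
    simp only [Set.mem_ofPred_eq, ContinuousMap.coe_zero, extend_zero]
    exact differentiableOn_const 0
  smul_mem' := by
    intro c f hf
    simp only [Set.mem_ofPred_eq, ContinuousMap.coe_smul, extend_smul] at *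
    exact hf.const_smul c

/-- The holomorphic function `f` as a function on the plane (zero outside the disk). -/
def fn (f : Hol) : ℂ → ℂ := extend (f : C(Disk, ℂ))

/-- The derivative `f'`. -/
def der (f : Hol) : ℂ → ℂ := deriv (fn f)

/-- The `n`-th Taylor coefficient of `f` at the origin. -/
def coeff (f : Hol) (n : ℕ) : ℂ := iteratedDeriv n (fn f) 0 / (n.factorial : ℂ)

/-- `ℓ¹₋₁`: the functions in `H(𝔻)` whose Taylor coefficients satisfy
`∑ |f̂(n)| / (n + 1) < ∞`. -/
def ellOne : Set Hol := {f | Summable fun n : ℕ => ‖coeff f n‖ / ((n : ℝ) + 1)}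

/-- The weight `log^α (2 / (1 - |z|))`. -/
def weight (α : ℝ) (z : ℂ) : ℝ := Real.log (2 / (1 - ‖z‖)) ^ α

/-- The logarithmic Bloch space: `|f'(z)| = O((1 - |z|)⁻¹ log^α (2 / (1 - |z|)))`. -/
def bloch (α : ℝ) : Set Hol :=
  {f | ∃ C : ℝ, ∀ z ∈ Metric.ball (0 : ℂ) 1, ‖der f z‖ ≤ C * ((1 - ‖z‖)⁻¹ * weight α z)}

/-- Normalized Lebesgue measure on the disk. -/
def area : Measure ℂ :=
  (ENNReal.ofReal Real.pi)⁻¹ • (volume : Measure ℂ).restrict (Metric.ball 0 1)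

theorem ae_area : ∀ᵐ z ∂area, z ∈ Metric.ball (0 : ℂ) 1 :=
  Measure.ae_smul_measure (ae_restrict_mem measurableSet_ball) _

theorem differentiableAt_fn (f : Hol) {z : ℂ} (hz : z ∈ Metric.ball (0 : ℂ) 1) :
    DifferentiableAt ℂ (fn f) z :=
  DifferentiableOn.differentiableAt (f.2 : DifferentiableOn ℂ (extend _) _)
    (Metric.isOpen_ball.mem_nhds hz)

theorem fn_add (f g : Hol) : fn (f + g) = fn f + fn g := extend_add _ _

theorem fn_smul (c : ℂ) (f : Hol) : fn (c • f) = c • fn f := extend_smul _ _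

theorem fn_zero : fn (0 : Hol) = 0 := extend_zero

theorem der_add (f g : Hol) {z : ℂ} (hz : z ∈ Metric.ball (0 : ℂ) 1) :
    der (f + g) z = der f z + der g z := by
  rw [der, fn_add]
  exact deriv_add (differentiableAt_fn f hz) (differentiableAt_fn g hz)

theorem der_smul (c : ℂ) (f : Hol) {z : ℂ} (hz : z ∈ Metric.ball (0 : ℂ) 1) :
    der (c • f) z = c * der f z := by
  rw [der, fn_smul]
  exact deriv_const_smul c (differentiableAt_fn f hz)

theorem der_zero (z : ℂ) : der (0 : Hol) z = 0 := by
  rw [der, fn_zero]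
  exact deriv_const z 0

theorem weight_pos (α : ℝ) {z : ℂ} (hz : z ∈ Metric.ball (0 : ℂ) 1) : 0 < weight α z := by
  have h1 : ‖z‖ < 1 := by simpa using hz
  apply Real.rpow_pos_of_pos
  apply Real.log_pos
  rw [lt_div_iff₀ (by linarith)]
  linarith [norm_nonneg z]

theorem measurable_integrand (α : ℝ) (f : Hol) :
    Measurable fun z => ‖der f z‖ * weight α z := by
  have h : Measurable (der f) := measurable_deriv _
  unfold weight
  fun_prop

/-- The space `𝔅¹_{log^α}` as a subspace of `H(𝔻)`:
`∫ |f'(z)| log^α (2 / (1 - |z|)) dA(z) < ∞`. -/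
def blochOne (α : ℝ) : Submodule ℂ Hol where
  carrier := {f | Integrable (fun z => ‖der f z‖ * weight α z) area}
  add_mem' := by
    intro f g hf hg
    refine Integrable.mono' (Integrable.add hf hg)
      (measurable_integrand α _).aestronglyMeasurable ?_
    filter_upwards [ae_area] with z hz
    have hw := weight_pos α hz
    rw [Real.norm_of_nonneg (by positivity), der_add f g hz, Pi.add_apply, ← add_mul]
    exact mul_le_mul_of_nonneg_right (norm_add_le _ _) hw.le
  zero_mem' := by simp [der_zero]
  smul_mem' := by
    intro c f hf
    refine (Integrable.const_mul hf ‖c‖).congr ?_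
    filter_upwards [ae_area] with z hz
    rw [der_smul c f hz, norm_mul, mul_assoc]

/-- The space `𝔅¹_{log^α}` as a space of its own, to be endowed with its own norm rather than
with the topology inherited from `H(𝔻)`. -/
def BlochOne (α : ℝ) : Type := blochOne α

instance (α : ℝ) : AddCommGroup (BlochOne α) :=
  inferInstanceAs (AddCommGroup (blochOne α))

instance (α : ℝ) : Module ℂ (BlochOne α) := inferInstanceAs (Module ℂ (blochOne α))

/-- The element of `H(𝔻)` underlying an element of `𝔅¹_{log^α}`. -/
def BlochOne.toHol {α : ℝ} (f : BlochOne α) : Hol := Subtype.val (p := (· ∈ blochOne α)) f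

theorem BlochOne.integrable {α : ℝ} (f : BlochOne α) :
    Integrable (fun z => ‖der f.toHol z‖ * weight α z) area :=
  Subtype.property (p := (· ∈ blochOne α)) f

theorem BlochOne.toHol_add {α : ℝ} (f g : BlochOne α) : (f + g).toHol = f.toHol + g.toHol := rfl

theorem BlochOne.toHol_smul {α : ℝ} (c : ℂ) (f : BlochOne α) : (c • f).toHol = c • f.toHol := rfl

theorem BlochOne.toHol_zero {α : ℝ} : (0 : BlochOne α).toHol = 0 := rfl

theorem BlochOne.ext {α : ℝ} {f g : BlochOne α} (h : f.toHol = g.toHol) : f = g :=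
  Subtype.ext h

/-- The norm `|f(0)| + ∫ |f'(z)| log^α (2 / (1 - |z|)) dA(z)`. -/
instance (α : ℝ) : Norm (BlochOne α) where
  norm f := ‖fn f.toHol 0‖ + ∫ z, ‖der f.toHol z‖ * weight α z ∂area

theorem BlochOne.norm_def {α : ℝ} (f : BlochOne α) :
    ‖f‖ = ‖fn f.toHol 0‖ + ∫ z, ‖der f.toHol z‖ * weight α z ∂area := rfl

theorem integrand_nonneg (α : ℝ) (f : Hol) : 0 ≤ᵐ[area] fun z => ‖der f z‖ * weight α z := by
  filter_upwards [ae_area] with z hz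
  exact mul_nonneg (norm_nonneg _) (weight_pos α hz).le

theorem BlochOne.eq_zero_of_norm {α : ℝ} (f : BlochOne α) (h : ‖f‖ = 0) : f = 0 := by
  rw [BlochOne.norm_def] at h
  have hI := integral_nonneg_of_ae (integrand_nonneg α f.toHol)
  have h0 : ‖fn f.toHol 0‖ = 0 := by linarith [norm_nonneg (fn f.toHol 0)]
  have h1 : ∫ z, ‖der f.toHol z‖ * weight α z ∂area = 0 := by
    linarith [norm_nonneg (fn f.toHol 0)]
  rw [integral_eq_zero_iff_of_nonneg_ae (integrand_nonneg α f.toHol) f.integrable] at h1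
  have hpi : (ENNReal.ofReal Real.pi)⁻¹ ≠ 0 := by simp
  have h2 : ∀ᵐ z ∂(volume : Measure ℂ).restrict (Metric.ball 0 1), der f.toHol z = 0 := by
    have h3 : ∀ᵐ z ∂area, der f.toHol z = 0 := by
      filter_upwards [h1, ae_area] with z hz hz'
      have hw := weight_pos α hz'
      simpa [hw.ne'] using hz
    rw [ae_iff] at h3 ⊢
    simpa [area, hpi] using h3
  have hdiff : DifferentiableOn ℂ (fn f.toHol) (Metric.ball 0 1) :=
    (f.toHol.2 : DifferentiableOn ℂ (extend _) _)
  have hcont : ContinuousOn (der f.toHol) (Metric.ball 0 1) :=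
    (hdiff.deriv Metric.isOpen_ball).continuousOn
  have h4 : Set.EqOn (der f.toHol) (fun _ => 0) (Metric.ball 0 1) :=
    Measure.eqOn_open_of_ae_eq h2 Metric.isOpen_ball hcont continuousOn_const
  apply BlochOne.ext
  apply Subtype.ext
  ext z
  have h5 : fn f.toHol z = fn f.toHol 0 :=
    Metric.isOpen_ball.is_const_of_deriv_eq_zero (convex_ball (0 : ℂ) 1).isPreconnected hdiff h4
      z.2 (by simp)
  rw [norm_eq_zero.1 h0, fn, extend_apply] at h5
  simpa [BlochOne.toHol_zero] using h5

theorem BlochOne.core (α : ℝ) : NormedSpace.Core ℂ (BlochOne α) where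
  norm_nonneg f := add_nonneg (norm_nonneg _)
    (integral_nonneg_of_ae (integrand_nonneg α f.toHol))
  norm_smul c f := by
    rw [BlochOne.norm_def, BlochOne.norm_def, BlochOne.toHol_smul, fn_smul, Pi.smul_apply,
      norm_smul, mul_add, ← integral_const_mul]
    congr 1
    apply integral_congr_ae
    filter_upwards [ae_area] with z hz
    rw [der_smul c _ hz, norm_mul, mul_assoc]
  norm_triangle f g := by
    rw [BlochOne.norm_def, BlochOne.norm_def, BlochOne.norm_def, BlochOne.toHol_add, fn_add,
      Pi.add_apply]
    have h : ∫ z, ‖der (f.toHol + g.toHol) z‖ * weight α z ∂area ≤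
        (∫ z, ‖der f.toHol z‖ * weight α z ∂area) +
          ∫ z, ‖der g.toHol z‖ * weight α z ∂area := by
      rw [← integral_add f.integrable g.integrable]
      refine integral_mono_ae (f + g).integrable (f.integrable.add g.integrable) ?_
      filter_upwards [ae_area] with z hz
      have hw := weight_pos α hz
      rw [der_add _ _ hz, ← add_mul]
      exact mul_le_mul_of_nonneg_right (norm_add_le _ _) hw.le
    linarith [norm_add_le (fn f.toHol 0) (fn g.toHol 0)]
  norm_eq_zero_iff f := by
    refine ⟨BlochOne.eq_zero_of_norm f, ?_⟩
    rintro rfl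
    simp [BlochOne.norm_def, BlochOne.toHol_zero, fn_zero, der_zero]

instance (α : ℝ) : NormedAddCommGroup (BlochOne α) :=
  NormedAddCommGroup.ofCore (BlochOne.core α)

instance (α : ℝ) : NormedSpace ℂ (BlochOne α) :=
  NormedSpace.ofCore (BlochOne.core α)

/-- The functions in `H(𝔻)` that are holomorphic in a neighbourhood of the closed disk. -/
def holClosed : Set Hol :=
  {f | ∃ F : ℂ → ℂ, AnalyticOnNhd ℂ F (Metric.closedBall 0 1) ∧ ∀ z : Disk, f.1 z = F z}

/-- The Libera transform `∫₀¹ f (t + (1 - t) z) dt`. -/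
def libera (f : Hol) (z : Disk) : ℂ :=
  ∫ t in (0 : ℝ)..1, fn f ((t : ℂ) + (1 - (t : ℂ)) * (z : ℂ))

end LogBloch

end

open MeasureTheory
open scoped Real

/-! Everything is read off from `f'`. If `b n` is the modulus of the `n`-th Taylor coefficient of
`f'`, membership in `ellOne` follows from summability of `b n / (n+1)^2`.

For (a), Bessel's inequality on the circle of radius `1 - 2^{-(k+1)}` bounds the sum of `b n ^ 2`
over the block `2^k ≤ n+1 < 2^{k+1}` by a constant times `(2^k k^α)^2`. Cauchy–Schwarz makes the
block contribute `O(k^α 2^{-k/2})`, which is summable for every `α`.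

For `α ≥ 0` the weight is bounded below, so `f'` is area integrable. Integrating `b n r^n ≤ (mean of
|f'| on |z| = r)` against `r · r^n (1-r)` and summing costs nothing, because `∑ r^n (1-r) ≤ 1`, and
leaves `b n / ((2n+2)(2n+3))` on the left (`mem_ellOne_of_integrableOn`).

For `α < 0` the test functions are `1/(1-ρz)`. Their integral over `[0,1]`, which is the Libera
transform at `0`, is at least `ℓ = log (1/(1-ρ))`. The unweighted area integral of the derivative is
at most `2ℓ`, and a weight that vanishes at the boundary makes it `o(ℓ)`
(`exists_lintegral_geomKernelDeriv_le`). This rules out a bounded extension. Summing such kernels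
divided by `ℓ` gives a function of `𝔅¹_{log^α}` not integrable on `[0,1)`, whereas every function in
`ellOne` is integrable there (`lintegral_fn_lt_top`). -/

namespace LogBloch

/-! ### Taylor coefficients and circles -/

/-- Restriction of a function holomorphic on the disk to a smaller circle has the Taylor
coefficients as Fourier coefficients. -/
theorem fourierCoeffOn_circleMap {h : ℂ → ℂ} (hh : DifferentiableOn ℂ h (Metric.ball 0 1))
    {r : ℝ} (hr0 : 0 < r) (hr1 : r < 1) (n : ℕ) :
    fourierCoeffOn Real.two_pi_pos (fun θ => h (circleMap 0 r θ)) n =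
      iteratedDeriv n h 0 / (n.factorial : ℂ) * (r : ℂ) ^ n := by
  have hsub : Metric.closedBall (0 : ℂ) r ⊆ Metric.ball 0 1 :=
    Metric.closedBall_subset_ball hr1
  have key := Complex.circleIntegral_one_div_sub_center_pow_smul_of_differentiable_on_off_countable
    (c := 0) (f := h) hr0 n Set.countable_empty (hh.continuousOn.mono hsub)
    (fun z hz => hh.differentiableAt (Metric.isOpen_ball.mem_nhds
      (hsub (Metric.ball_subset_closedBall hz.1))))
  rw [fourierCoeffOn_eq_integral]
  have hrc : (r : ℂ) ≠ 0 := by exact_mod_cast hr0.ne'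
  have hpi : (π : ℂ) ≠ 0 := by exact_mod_cast Real.pi_ne_zero
  -- With `dz = i r e^{iθ} dθ`, the Cauchy kernel `z^{-(n+1)} dz` becomes `i r^{-n} e^{-inθ} dθ`.
  have e1 : (∮ z in C(0, r), (1 / (z - 0) ^ (n + 1)) • h z) =
      (Complex.I / (r : ℂ) ^ n) * ∫ θ in (0 : ℝ)..2 * π,
        fourier (-(n : ℤ)) (θ : AddCircle (2 * π - 0)) • h (circleMap 0 r θ) := by
    rw [circleIntegral, ← intervalIntegral.integral_const_mul]
    congr 1
    funext θ
    rw [fourier_coe_apply]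
    have e2 : Complex.exp (2 * π * Complex.I * ((-(n : ℤ) : ℤ) : ℂ) * θ / ((2 * π - 0 : ℝ) : ℂ)) =
        (Complex.exp (θ * Complex.I) ^ n)⁻¹ := by
      rw [← Complex.exp_nat_mul, ← Complex.exp_neg]
      congr 1
      push_cast
      field_simp
      ring
    rw [e2, deriv_circleMap]
    have hexp := Complex.exp_ne_zero (θ * Complex.I)
    simp only [circleMap, zero_add, sub_zero, smul_eq_mul]
    field_simp
    ring
  rw [e1] at key
  rw [Complex.real_smul]
  have hfac : (n.factorial : ℂ) ≠ 0 := by exact_mod_cast n.factorial_ne_zero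
  rw [smul_eq_mul] at key
  generalize (∫ θ in (0 : ℝ)..2 * π,
        fourier (-(n : ℤ)) (θ : AddCircle (2 * π - 0)) • h (circleMap 0 r θ)) = J at key ⊢
  have hI := Complex.I_ne_zero
  field_simp at key
  push_cast
  field_simp
  linear_combination key

theorem continuous_comp_circleMap {h : ℂ → ℂ} (hh : ContinuousOn h (Metric.ball 0 1))
    {r : ℝ} (hr0 : 0 < r) (hr1 : r < 1) : Continuous fun θ => h (circleMap 0 r θ) := by
  refine hh.comp_continuous (continuous_circleMap 0 r) fun θ => ?_
  simpa [abs_of_pos hr0] using hr1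

/-- **Bessel's inequality** for the Taylor coefficients of a function bounded on a circle. -/
theorem sum_sq_coeff_le {h : ℂ → ℂ} (hh : DifferentiableOn ℂ h (Metric.ball 0 1))
    {r : ℝ} (hr0 : 0 < r) (hr1 : r < 1) {M : ℝ} (hM : ∀ z : ℂ, ‖z‖ = r → ‖h z‖ ≤ M)
    (s : Finset ℕ) :
    ∑ n ∈ s, (‖iteratedDeriv n h 0 / (n.factorial : ℂ)‖ * r ^ n) ^ 2 ≤ M ^ 2 := by
  have hc := continuous_comp_circleMap hh.continuousOn hr0 hr1
  have hb : ∀ θ, ‖h (circleMap 0 r θ)‖ ≤ M := fun θ => hM _ (by simp [abs_of_pos hr0])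
  have hM0 : 0 ≤ M := (norm_nonneg _).trans (hb 0)
  have hL2 : MemLp (fun θ => h (circleMap 0 r θ)) 2 (volume.restrict (Set.Ioc 0 (2 * π))) :=
    MemLp.of_bound hc.aestronglyMeasurable M (Filter.Eventually.of_forall hb)
  have hP := hasSum_sq_fourierCoeffOn Real.two_pi_pos hL2
  -- Parseval, keeping only finitely many nonnegative frequencies.
  have h1 := sum_le_hasSum (s.map ⟨((↑) : ℕ → ℤ), Nat.cast_injective⟩)
    (fun i _ => by positivity) hP
  rw [Finset.sum_map] at h1
  simp only [Function.Embedding.coeFn_mk, fourierCoeffOn_circleMap hh hr0 hr1, norm_mul, norm_pow,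
    Complex.norm_real, Real.norm_of_nonneg hr0.le] at h1
  refine h1.trans ?_
  have h2 : ∫ θ in (0 : ℝ)..2 * π, ‖h (circleMap 0 r θ)‖ ^ 2 ≤ ∫ θ in (0 : ℝ)..2 * π, M ^ 2 := by
    refine intervalIntegral.integral_mono_on Real.two_pi_pos.le
      ((hc.norm.pow 2).intervalIntegrable _ _) (by simp) fun θ _ => ?_
    gcongr
    exact hb θ
  rw [intervalIntegral.integral_const] at h2
  rw [smul_eq_mul] at h2 ⊢
  have := Real.pi_pos
  rw [inv_mul_le_iff₀ (by linarith)]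
  exact h2

/-- The Taylor coefficients are dominated by integral means over circles. -/
theorem norm_coeff_mul_pow_le {h : ℂ → ℂ} (hh : DifferentiableOn ℂ h (Metric.ball 0 1))
    {r : ℝ} (hr0 : 0 < r) (hr1 : r < 1) (n : ℕ) :
    2 * π * (‖iteratedDeriv n h 0 / (n.factorial : ℂ)‖ * r ^ n) ≤
      ∫ θ in (0 : ℝ)..2 * π, ‖h (circleMap 0 r θ)‖ := by
  have e := congrArg norm (fourierCoeffOn_circleMap hh hr0 hr1 n)
  rw [norm_mul, norm_pow, Complex.norm_real, Real.norm_of_nonneg hr0.le,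
    fourierCoeffOn_eq_integral, norm_smul] at e
  rw [← e]
  have hpi := Real.pi_pos
  have h2 := intervalIntegral.norm_integral_le_integral_norm (μ := volume)
    (f := fun θ => fourier (-(n : ℤ)) (θ : AddCircle (2 * π - 0)) • h (circleMap 0 r θ))
    Real.two_pi_pos.le
  have h3 : ∀ θ : ℝ, ‖fourier (-(n : ℤ)) (θ : AddCircle (2 * π - 0)) • h (circleMap 0 r θ)‖ =
      ‖h (circleMap 0 r θ)‖ := fun θ => by
    rw [norm_smul, fourier_apply, Circle.norm_coe, one_mul]
  simp_rw [h3] at h2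
  have h4 : 2 * π * ‖1 / (2 * π - 0)‖ = 1 := by
    rw [sub_zero, Real.norm_of_nonneg (by positivity), mul_one_div_cancel (by positivity)]
  rw [← mul_assoc, h4, one_mul]
  exact h2

/-! ### Polar coordinates -/

/-- Integration over the disk in polar coordinates. -/
theorem lintegral_ball_polar {F : ℂ → ENNReal} (hF : Measurable F) :
    ∫⁻ z in Metric.ball (0 : ℂ) 1, F z = ∫⁻ r in Set.Ioo (0 : ℝ) 1,
      ENNReal.ofReal r * ∫⁻ θ in Set.Ioo (-π) π, F (circleMap 0 r θ) := by
  have hsymm : ∀ p : ℝ × ℝ, Complex.polarCoord.symm p = circleMap 0 p.1 p.2 := fun p => by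
    rw [Complex.polarCoord_symm_apply, circleMap, zero_add, Complex.exp_mul_I]
    push_cast
    rfl
  have hmeas : Measurable fun p : ℝ × ℝ => circleMap 0 p.1 p.2 := by
    unfold circleMap
    fun_prop
  have hG : Measurable ((Metric.ball (0 : ℂ) 1).indicator F) := hF.indicator measurableSet_ball
  rw [← lintegral_indicator measurableSet_ball, ← Complex.lintegral_comp_polarCoord_symm]
  simp_rw [hsymm, smul_eq_mul]
  rw [polarCoord_target, Measure.volume_eq_prod, ← Measure.prod_restrict, lintegral_prod]
  · rw [← lintegral_indicator measurableSet_Ioi, ← lintegral_indicator measurableSet_Ioo]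
    congr 1
    funext r
    by_cases h0 : 0 < r
    · rw [Set.indicator_of_mem (Set.mem_Ioi.2 h0)]
      dsimp only
      rw [lintegral_const_mul]
      · by_cases h1 : r < 1
        · rw [Set.indicator_of_mem (Set.mem_Ioo.2 ⟨h0, h1⟩)]
          congr 2
          funext θ
          rw [Set.indicator_of_mem (by simpa [abs_of_pos h0] using h1)]
        · rw [Set.indicator_of_notMem (fun h => h1 h.2)]
          have : ∀ θ, (Metric.ball (0 : ℂ) 1).indicator F (circleMap 0 r θ) = 0 := fun θ =>
            Set.indicator_of_notMem (by simpa [abs_of_pos h0] using h1) _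
          simp [this]
      · exact hG.comp (hmeas.comp measurable_prodMk_left)
    · rw [Set.indicator_of_notMem (mt Set.mem_Ioi.1 h0),
        Set.indicator_of_notMem (fun h => h0 h.1)]
  · exact ((ENNReal.measurable_ofReal.comp measurable_fst).mul (hG.comp hmeas)).aemeasurable

/-- Polar coordinates use the angles `(-π, π)` and circle integrals use `[0, 2π]`; periodicity
reconciles the two. -/
theorem lintegral_circle_eq {h : ℂ → ℂ} (hh : ContinuousOn h (Metric.ball 0 1))
    {r : ℝ} (hr0 : 0 < r) (hr1 : r < 1) :
    ∫⁻ θ in Set.Ioo (-π) π, ENNReal.ofReal ‖h (circleMap 0 r θ)‖ =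
      ENNReal.ofReal (∫ θ in (0 : ℝ)..2 * π, ‖h (circleMap 0 r θ)‖) := by
  have hc := (continuous_comp_circleMap hh hr0 hr1).norm
  have hper : Function.Periodic (fun θ => ‖h (circleMap 0 r θ)‖) (2 * π) := fun θ => by
    simp only [periodic_circleMap 0 r θ]
  have e := hper.intervalIntegral_add_eq (-π) 0
  rw [show -π + 2 * π = π by ring, zero_add] at e
  rw [← e, intervalIntegral.integral_of_le (by linarith [Real.pi_pos]),
    ← restrict_Ioo_eq_restrict_Ioc,
    ofReal_integral_eq_lintegral_ofReal _ (Filter.Eventually.of_forall fun θ => norm_nonneg _)]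
  exact (hc.integrableOn_Icc).mono_set Set.Ioo_subset_Icc_self

/-! ### Coefficients of the derivative -/

theorem der_differentiableOn (f : Hol) : DifferentiableOn ℂ (der f) (Metric.ball 0 1) :=
  DifferentiableOn.deriv (f.2 : DifferentiableOn ℂ (extend _) _) Metric.isOpen_ball

theorem norm_coeff_succ (f : Hol) (n : ℕ) :
    ‖coeff f (n + 1)‖ = ‖iteratedDeriv n (der f) 0 / (n.factorial : ℂ)‖ / ((n : ℝ) + 1) := by
  have h : ‖(n : ℂ) + 1‖ = (n : ℝ) + 1 := by
    rw [← Nat.cast_add_one, Complex.norm_natCast, Nat.cast_add_one]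
  rw [coeff, iteratedDeriv_succ', der, Nat.factorial_succ, Nat.cast_mul, norm_div, norm_div,
    norm_mul, Nat.cast_add_one, h, div_div, mul_comm]

/-- Membership in `ℓ¹₋₁` in terms of the derivative. -/
theorem mem_ellOne_of_summable {f : Hol} (h : Summable fun n : ℕ =>
    ‖iteratedDeriv n (der f) 0 / (n.factorial : ℂ)‖ / ((n : ℝ) + 1) ^ 2) : f ∈ ellOne := by
  change Summable fun n : ℕ => ‖coeff f n‖ / ((n : ℝ) + 1)
  -- The constant term is irrelevant; after the shift the denominator is `(n+1)(n+2) ≥ (n+1)^2`.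
  rw [← summable_nat_add_iff 1]
  refine Summable.of_nonneg_of_le (fun n => by positivity) (fun n => ?_) h
  rw [norm_coeff_succ, div_div]
  gcongr
  push_cast
  nlinarith [(Nat.cast_nonneg n : (0 : ℝ) ≤ n)]

/-! ### Logarithmic Bloch functions: dyadic blocks -/

/-- Summability of a nonnegative sequence from bounds on its dyadic blocks. -/
theorem summable_of_dyadic_le {u v : ℕ → ℝ} (hu : ∀ n, 0 ≤ u n) (hv : Summable v)
    (h : ∀ (k : ℕ) (s : Finset ℕ), (∀ n ∈ s, Nat.log 2 (n + 1) = k) → ∑ n ∈ s, u n ≤ v k) :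
    Summable u := by
  have hv0 : ∀ k, 0 ≤ v k := fun k => by simpa using h k ∅ (by simp)
  refine summable_of_sum_le hu (c := ∑' k, v k) fun s => ?_
  rw [← Finset.sum_fiberwise_of_maps_to (t := s.image fun n => Nat.log 2 (n + 1))
    (g := fun n => Nat.log 2 (n + 1)) (fun n hn => Finset.mem_image_of_mem _ hn)]
  refine (Finset.sum_le_sum fun k _ => h k _ fun n hn => (Finset.mem_filter.1 hn).2).trans ?_
  exact hv.sum_le_tsum _ fun k _ => hv0 k

/-- Bernoulli gives `(1 - 2^{-(k+1)})^{2^k} ≥ 1/2`; squaring reaches the exponent `2^{k+1} > n`. -/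
theorem quarter_le_pow {k n : ℕ} (h : n + 1 < 2 ^ (k + 1)) :
    1 / 4 ≤ (1 - 1 / (2 : ℝ) ^ (k + 1)) ^ n := by
  have hk : (1 : ℝ) ≤ 2 ^ k := one_le_pow₀ (by norm_num)
  have h0 : 0 ≤ 1 - 1 / (2 : ℝ) ^ (k + 1) := by
    rw [sub_nonneg, div_le_one (by positivity), pow_succ]
    linarith
  have h1 : 1 - 1 / (2 : ℝ) ^ (k + 1) ≤ 1 := by
    have : (0 : ℝ) < 1 / 2 ^ (k + 1) := by positivity
    linarith
  have hB := one_add_mul_le_pow (a := -(1 / (2 : ℝ) ^ (k + 1))) (by linarith) (2 ^ k)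
  have e : 1 + ((2 ^ k : ℕ) : ℝ) * -(1 / (2 : ℝ) ^ (k + 1)) = 1 / 2 := by
    push_cast
    rw [pow_succ]
    field_simp
    norm_num
  rw [e, ← sub_eq_add_neg] at hB
  calc (1 / 4 : ℝ) = (1 / 2) ^ 2 := by norm_num
    _ ≤ ((1 - 1 / (2 : ℝ) ^ (k + 1)) ^ (2 ^ k)) ^ 2 := by gcongr
    _ = (1 - 1 / (2 : ℝ) ^ (k + 1)) ^ (2 ^ (k + 1)) := by rw [← pow_mul, ← pow_succ]
    _ ≤ _ := pow_le_pow_of_le_one h0 h1 (by omega)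

/-- A natural exponent `m ≥ α` dominates because the base `k + 2` is at least `1`. Shifting the
series for `n^m q^n` by two accounts for the factor `q^{-2}`. -/
theorem summable_rpow_mul_geometric (α : ℝ) {q : ℝ} (hq0 : 0 < q) (hq1 : q < 1) :
    Summable fun k : ℕ => (((k : ℝ) + 2) * Real.log 2) ^ α * q ^ k := by
  obtain ⟨m, hm⟩ := exists_nat_ge α
  have h1 := summable_pow_mul_geometric_of_norm_lt_one (R := ℝ) m (r := q)
    (by rwa [Real.norm_of_nonneg hq0.le])
  have h2 := ((summable_nat_add_iff 2).2 h1).mul_left (Real.log 2 ^ α * (q ^ 2)⁻¹)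
  have hl : 0 < Real.log 2 := Real.log_pos (by norm_num)
  refine Summable.of_nonneg_of_le (fun k => by positivity) (fun k => ?_) h2
  rw [Real.mul_rpow (by positivity) hl.le]
  have h3 : ((k : ℝ) + 2) ^ α ≤ ((k : ℝ) + 2) ^ m := by
    rw [← Real.rpow_natCast]
    exact Real.rpow_le_rpow_of_exponent_le (by linarith [(Nat.cast_nonneg k : (0 : ℝ) ≤ k)]) hm
  calc ((k : ℝ) + 2) ^ α * Real.log 2 ^ α * q ^ k
      ≤ ((k : ℝ) + 2) ^ m * Real.log 2 ^ α * q ^ k := by gcongr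
    _ = _ := by
      push_cast
      field_simp
      ring

theorem weight_eq_of_norm {k : ℕ} {z : ℂ} (hz : ‖z‖ = 1 - 1 / (2 : ℝ) ^ (k + 1)) (α : ℝ) :
    (1 - ‖z‖)⁻¹ * weight α z = 2 ^ (k + 1) * (((k : ℝ) + 2) * Real.log 2) ^ α := by
  have h : (2 : ℝ) / (1 / 2 ^ (k + 1)) = 2 ^ (k + 2) := by
    rw [div_div_eq_mul_div, div_one, ← pow_succ']
  rw [weight, hz, sub_sub_cancel, h, Real.log_pow, one_div, inv_inv]
  push_cast
  rfl

/-- Logarithmic Bloch functions have coefficients in the weighted sequence space. -/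
theorem bloch_subset_ellOne (α : ℝ) : bloch α ⊆ ellOne := by
  rintro f ⟨C, hC⟩
  apply mem_ellOne_of_summable
  set b : ℕ → ℝ := fun n => ‖iteratedDeriv n (der f) 0 / (n.factorial : ℂ)‖ with hb
  have hl : 0 < Real.log 2 := Real.log_pos (by norm_num)
  set W : ℕ → ℝ := fun k => (((k : ℝ) + 2) * Real.log 2) ^ α with hW
  have hW0 : ∀ k, 0 < W k := fun k => by positivity
  have hq0 : 0 < Real.sqrt 2 / 2 := by positivity
  have hq1 : Real.sqrt 2 / 2 < 1 := by
    nlinarith [Real.sqrt_nonneg 2, Real.sq_sqrt (show (0 : ℝ) ≤ 2 by norm_num)]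
  have hC0 : 0 ≤ C := by
    have := (norm_nonneg _).trans (hC 0 (by simp))
    have hw := weight_pos α (show (0 : ℂ) ∈ Metric.ball (0 : ℂ) 1 by simp)
    refine nonneg_of_mul_nonneg_left this ?_
    simpa using hw
  refine summable_of_dyadic_le (fun n => by positivity)
    ((summable_rpow_mul_geometric α hq0 hq1).mul_left (8 * C)) fun k s hs => ?_
  have hlog : ∀ n ∈ s, 2 ^ k ≤ n + 1 ∧ n + 1 < 2 ^ (k + 1) := fun n hn => by
    rw [← hs n hn]
    exact ⟨Nat.pow_log_le_self 2 (by omega), Nat.lt_pow_succ_log_self (by norm_num) _⟩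
  have hk : (1 : ℝ) ≤ 2 ^ k := one_le_pow₀ (by norm_num)
  have hr1 : 1 - 1 / (2 : ℝ) ^ (k + 1) < 1 := by
    have : (0 : ℝ) < 1 / 2 ^ (k + 1) := by positivity
    linarith
  have hr0 : 0 < 1 - 1 / (2 : ℝ) ^ (k + 1) := by
    rw [sub_pos, div_lt_one (by positivity), pow_succ]
    linarith
  have hM : ∀ z : ℂ, ‖z‖ = 1 - 1 / (2 : ℝ) ^ (k + 1) → ‖der f z‖ ≤ C * (2 ^ (k + 1) * W k) := by
    intro z hz
    have := hC z (by rw [mem_ball_zero_iff, hz]; exact hr1)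
    rwa [weight_eq_of_norm hz] at this
  have hB := sum_sq_coeff_le (der_differentiableOn f) hr0 hr1 hM s
  -- On the block `r^n ≥ 1/4`, so removing `r^n` from Bessel's inequality costs a factor `4`.
  have hsq : ∑ n ∈ s, b n ^ 2 ≤ (4 * (C * (2 ^ (k + 1) * W k))) ^ 2 := by
    rw [mul_pow]
    refine le_trans ?_ (mul_le_mul_of_nonneg_left hB (by norm_num))
    rw [Finset.mul_sum]
    refine Finset.sum_le_sum fun n hn => ?_
    rw [← mul_pow]
    have h4 := quarter_le_pow (hlog n hn).2
    have hbn : 0 ≤ b n := norm_nonneg _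
    refine pow_le_pow_left₀ hbn ?_ 2
    calc b n = 4 * (b n * (1 / 4)) := by ring
      _ ≤ 4 * (b n * (1 - 1 / (2 : ℝ) ^ (k + 1)) ^ n) := by gcongr
  have hcard : (s.card : ℝ) ≤ 2 ^ k := by
    have : s ⊆ Finset.Ico (2 ^ k - 1) (2 ^ (k + 1) - 1) := fun n hn => by
      have := hlog n hn
      rw [Finset.mem_Ico]
      omega
    have h := Finset.card_le_card this
    rw [Nat.card_Ico, pow_succ] at h
    have h5 : s.card ≤ 2 ^ k := by omega
    exact_mod_cast h5
  -- Cauchy–Schwarz on a block of at most `2^k` indices.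
  have hsum : ∑ n ∈ s, b n ≤ Real.sqrt 2 ^ k * (4 * (C * (2 ^ (k + 1) * W k))) := by
    have hWk := hW0 k
    refine le_of_sq_le_sq ?_ (by positivity)
    rw [mul_pow (Real.sqrt 2 ^ k), ← pow_mul, mul_comm k 2, pow_mul, Real.sq_sqrt (by norm_num)]
    refine sq_sum_le_card_mul_sum_sq.trans ?_
    gcongr
  -- Since `n + 1 ≥ 2^k`, the powers of two combine to `2^{k/2} · 2^{k+1} / 4^k = 2 · 2^{-k/2}`.
  calc ∑ n ∈ s, b n / ((n : ℝ) + 1) ^ 2 ≤ ∑ n ∈ s, b n / (2 ^ k) ^ 2 := by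
        refine Finset.sum_le_sum fun n hn => ?_
        have hbn : 0 ≤ b n := norm_nonneg _
        have h6 : ((2 ^ k : ℕ) : ℝ) ≤ ((n + 1 : ℕ) : ℝ) := by exact_mod_cast (hlog n hn).1
        push_cast at h6
        gcongr
    _ = (∑ n ∈ s, b n) / (2 ^ k) ^ 2 := by rw [Finset.sum_div]
    _ ≤ Real.sqrt 2 ^ k * (4 * (C * (2 ^ (k + 1) * W k))) / (2 ^ k) ^ 2 := by gcongr
    _ = 8 * C * (W k * (Real.sqrt 2 / 2) ^ k) := by
        rw [pow_succ, div_pow]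
        field_simp
        ring

/-! ### Nonnegative exponents -/

theorem integrable_area_iff {g : ℂ → ℝ} :
    Integrable g area ↔ IntegrableOn g (Metric.ball 0 1) := by
  rw [area, integrable_smul_measure (by simp) (by simp [Real.pi_pos])]
  rfl

/-- For nonnegative exponents the weight is bounded below. -/
theorem integrableOn_der {α : ℝ} (hα : 0 ≤ α) {f : Hol} (hf : f ∈ blochOne α) :
    IntegrableOn (fun z => ‖der f z‖) (Metric.ball 0 1) := by
  have h1 : Integrable (fun z => ‖der f z‖ * weight α z) area := hf
  have hl : 0 < Real.log 2 := Real.log_pos (by norm_num)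
  rw [← integrable_area_iff]
  have hm : Measurable (der f) := measurable_deriv _
  refine (h1.mul_const (Real.log 2 ^ α)⁻¹).mono' hm.norm.aestronglyMeasurable ?_
  filter_upwards [ae_area] with z hz
  have hz1 : ‖z‖ < 1 := by simpa using hz
  have hw : Real.log 2 ^ α ≤ weight α z := by
    refine Real.rpow_le_rpow hl.le (Real.log_le_log (by norm_num) ?_) hα
    rw [le_div_iff₀ (by linarith)]
    linarith [norm_nonneg z]
  have hp : 0 < Real.log 2 ^ α := by positivity
  rw [norm_norm, mul_assoc]
  refine le_mul_of_one_le_right (norm_nonneg _) ?_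
  rw [← div_eq_mul_inv, one_le_div hp]
  exact hw

theorem integral_pow_mul_one_sub (n : ℕ) :
    ∫ r in (0 : ℝ)..1, r ^ (2 * n + 1) * (1 - r) = 1 / ((2 * n + 2) * (2 * n + 3)) := by
  have h : ∀ r : ℝ, r ^ (2 * n + 1) * (1 - r) = r ^ (2 * n + 1) - r ^ (2 * n + 2) := fun r => by
    ring
  simp_rw [h]
  rw [intervalIntegral.integral_sub (by simp) (by simp), integral_pow, integral_pow]
  push_cast
  simp only [one_pow, zero_pow (Nat.succ_ne_zero _), sub_zero]
  field_simp
  ring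

/-- Functions with integrable derivative on the disk have coefficients in the weighted
sequence space. -/
theorem mem_ellOne_of_integrableOn {f : Hol}
    (hf : IntegrableOn (fun z => ‖der f z‖) (Metric.ball 0 1)) : f ∈ ellOne := by
  apply mem_ellOne_of_summable
  set b : ℕ → ℝ := fun n => ‖iteratedDeriv n (der f) 0 / (n.factorial : ℂ)‖ with hb
  have hb0 : ∀ n, 0 ≤ b n := fun n => norm_nonneg _
  have hpi := Real.pi_pos
  set I := ∫⁻ z in Metric.ball (0 : ℂ) 1, ENNReal.ofReal ‖der f z‖ with hI
  have hItop : I ≠ ⊤ := hf.lintegral_lt_top.ne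
  have hm : Measurable (der f) := measurable_deriv _
  have hpolar : I = _ := lintegral_ball_polar (F := fun z => ENNReal.ofReal ‖der f z‖)
    (by fun_prop)
  refine summable_of_sum_range_le (c := 6 * I.toReal) (fun n => by positivity) fun N => ?_
  -- In `r^(2n+1) (1-r) = r^n · r · r^n (1-r)` the first `r^n` belongs to `b n`, the factor `r` is
  -- the Jacobian, and `r^n (1-r)` has partial sums at most `1`.
  set q : ℝ → ℝ := fun r => ∑ n ∈ Finset.range N, 2 * π * b n * (r ^ (2 * n + 1) * (1 - r)) with hq
  have hqc : Continuous q := by fun_prop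
  have hq0 : ∀ r ∈ Set.Ioo (0 : ℝ) 1, 0 ≤ q r := fun r hr => Finset.sum_nonneg fun n _ => by
    have := hb0 n
    have h1 : 0 ≤ 1 - r := by linarith [hr.2]
    have h2 := hr.1
    positivity
  have hle : ENNReal.ofReal (∫ r in (0 : ℝ)..1, q r) ≤ I := by
    rw [intervalIntegral.integral_of_le zero_le_one, ← restrict_Ioo_eq_restrict_Ioc,
      ofReal_integral_eq_lintegral_ofReal (hqc.integrableOn_Icc.mono_set Set.Ioo_subset_Icc_self)
        ((ae_restrict_iff' measurableSet_Ioo).2 (Filter.Eventually.of_forall hq0)), hpolar]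
    refine setLIntegral_mono' measurableSet_Ioo fun r hr => ?_
    rw [lintegral_circle_eq (der_differentiableOn f).continuousOn hr.1 hr.2,
      ← ENNReal.ofReal_mul hr.1.le]
    apply ENNReal.ofReal_le_ofReal
    set J := ∫ θ in (0 : ℝ)..2 * π, ‖der f (circleMap 0 r θ)‖ with hJ
    have hJ0 : 0 ≤ J := intervalIntegral.integral_nonneg (by positivity) fun _ _ => norm_nonneg _
    have h1r : 0 ≤ 1 - r := by linarith [hr.2]
    have hr0 := hr.1
    calc q r ≤ ∑ n ∈ Finset.range N, J * (r * (1 - r) * r ^ n) := by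
          refine Finset.sum_le_sum fun n _ => ?_
          have := norm_coeff_mul_pow_le (der_differentiableOn f) hr.1 hr.2 n
          calc 2 * π * b n * (r ^ (2 * n + 1) * (1 - r))
              = 2 * π * (b n * r ^ n) * (r * (1 - r) * r ^ n) := by ring
            _ ≤ _ := by gcongr
      _ = r * J * ((∑ n ∈ Finset.range N, r ^ n) * (1 - r)) := by
          rw [Finset.sum_mul, Finset.mul_sum]
          exact Finset.sum_congr rfl fun n _ => by ring
      _ ≤ r * J * 1 := by
          rw [geom_sum_mul_neg]
          have : 0 ≤ r ^ N := by positivity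
          gcongr
          linarith
      _ = r * J := mul_one _
  have hqi : ∫ r in (0 : ℝ)..1, q r =
      ∑ n ∈ Finset.range N, 2 * π * b n * (1 / ((2 * n + 2) * (2 * n + 3))) := by
    rw [hq, intervalIntegral.integral_finsetSum fun n _ => Continuous.intervalIntegrable
      (by fun_prop) _ _]
    refine Finset.sum_congr rfl fun n _ => ?_
    rw [intervalIntegral.integral_const_mul, integral_pow_mul_one_sub]
  have hfin := (ENNReal.ofReal_le_iff_le_toReal hItop).1 hle
  refine le_trans ?_ (mul_le_mul_of_nonneg_left hfin (by norm_num))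
  rw [hqi, Finset.mul_sum]
  refine Finset.sum_le_sum fun n _ => ?_
  have hn : (0 : ℝ) ≤ n := Nat.cast_nonneg n
  -- Since `(2n+2)(2n+3) ≤ 6 (n+1)^2`, the constant `6` is more than enough.
  have e : 6 * (2 * π * b n * (1 / ((2 * n + 2) * (2 * n + 3)))) =
      b n * (12 * π / ((2 * n + 2) * (2 * n + 3))) := by ring
  rw [e, div_eq_mul_inv]
  refine mul_le_mul_of_nonneg_left ?_ (hb0 n)
  rw [← one_div, div_le_div_iff₀ (by positivity) (by positivity)]
  nlinarith [Real.pi_gt_three, mul_nonneg hn hn, mul_nonneg hn hpi.le,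
    mul_nonneg (mul_nonneg hn hn) (sub_nonneg.2 Real.pi_gt_three.le),
    mul_nonneg hn (sub_nonneg.2 Real.pi_gt_three.le)]

theorem blochOne_subset_ellOne {α : ℝ} (hα : 0 ≤ α) : (blochOne α : Set Hol) ⊆ ellOne :=
  fun _ hf => mem_ellOne_of_integrableOn (integrableOn_der hα hf)

/-! ### The kernels `1 / (1 - ρ z)` -/

/-- The element of `H(𝔻)` given by a function holomorphic on the disk. -/
def holOf (g : ℂ → ℂ) (hg : DifferentiableOn ℂ g (Metric.ball 0 1)) : Hol :=
  ⟨⟨fun z => g z, hg.continuousOn.comp_continuous continuous_subtype_val fun z => z.2⟩, by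
    refine hg.congr fun z hz => ?_
    simp only [extend, dif_pos hz]
    rfl⟩

theorem fn_holOf {g : ℂ → ℂ} (hg : DifferentiableOn ℂ g (Metric.ball 0 1)) :
    Set.EqOn (fn (holOf g hg)) g (Metric.ball 0 1) := fun z hz =>
  extend_apply (holOf g hg).1 ⟨z, hz⟩

theorem der_holOf {g : ℂ → ℂ} (hg : DifferentiableOn ℂ g (Metric.ball 0 1)) :
    Set.EqOn (der (holOf g hg)) (deriv g) (Metric.ball 0 1) := fun _ hz =>
  ((fn_holOf hg).eventuallyEq_of_mem (Metric.isOpen_ball.mem_nhds hz)).deriv_eq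

/-- The function `1 / (1 - ρ z)`. -/
noncomputable def geomKernel (ρ : ℝ) (z : ℂ) : ℂ := (1 - ρ * z)⁻¹

/-- The derivative of `1 / (1 - ρ z)`. -/
noncomputable def geomKernelDeriv (ρ : ℝ) (z : ℂ) : ℂ := ρ / (1 - ρ * z) ^ 2

theorem le_norm_one_sub {ρ : ℝ} (h0 : 0 ≤ ρ) (z : ℂ) : 1 - ρ * ‖z‖ ≤ ‖1 - (ρ : ℂ) * z‖ := by
  have := norm_sub_norm_le (1 : ℂ) ((ρ : ℂ) * z)
  rwa [norm_one, norm_mul, Complex.norm_real, Real.norm_of_nonneg h0] at this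

theorem one_sub_norm_le {ρ : ℝ} (h0 : 0 ≤ ρ) (h1 : ρ ≤ 1) (z : ℂ) :
    1 - ‖z‖ ≤ ‖1 - (ρ : ℂ) * z‖ := by
  refine le_trans ?_ (le_norm_one_sub h0 z)
  nlinarith [norm_nonneg z]

theorem hasDerivAt_geomKernel {ρ : ℝ} {z : ℂ} (h : 1 - (ρ : ℂ) * z ≠ 0) :
    HasDerivAt (geomKernel ρ) (geomKernelDeriv ρ z) z := by
  have h1 : HasDerivAt (fun w : ℂ => 1 - (ρ : ℂ) * w) (-(ρ * 1)) z :=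
    ((hasDerivAt_id z).const_mul (ρ : ℂ)).const_sub 1
  refine (h1.inv h).congr_deriv ?_
  rw [geomKernelDeriv, mul_one, neg_neg]

theorem one_sub_ne_zero {ρ : ℝ} (h0 : 0 ≤ ρ) (h1 : ρ ≤ 1) {z : ℂ}
    (hz : z ∈ Metric.ball (0 : ℂ) 1) : 1 - (ρ : ℂ) * z ≠ 0 := by
  rw [← norm_pos_iff]
  have hz1 : ‖z‖ < 1 := by simpa using hz
  linarith [one_sub_norm_le h0 h1 z]

theorem measurable_geomKernelDeriv (ρ : ℝ) : Measurable (geomKernelDeriv ρ) := by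
  unfold geomKernelDeriv
  fun_prop

/-- The point is uniformity in `ρ`: it controls the inner disk when `ρ → 1` and allows termwise
differentiation of series of kernels. -/
theorem norm_geomKernelDeriv_le {ρ : ℝ} (h0 : 0 ≤ ρ) (h1 : ρ ≤ 1) {z : ℂ} {R : ℝ} (hR : R < 1)
    (hz : ‖z‖ ≤ R) : ‖geomKernelDeriv ρ z‖ ≤ ((1 - R) ^ 2)⁻¹ := by
  rw [geomKernelDeriv, norm_div, norm_pow, Complex.norm_real, Real.norm_of_nonneg h0,
    div_eq_mul_inv]
  have h2 : 1 - R ≤ ‖1 - (ρ : ℂ) * z‖ := by linarith [one_sub_norm_le h0 h1 z]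
  have h3 : 0 < 1 - R := by linarith
  calc ρ * (‖1 - (ρ : ℂ) * z‖ ^ 2)⁻¹ ≤ 1 * ((1 - R) ^ 2)⁻¹ := by gcongr
    _ = _ := one_mul _

/-- This integral serves twice: as the Libera transform at `0`, and as the radial integral bounding
the area integral of the derivative. Both are thus of order `log (1/(1-ρ))`, a balance that a
decaying weight destroys. -/
theorem integral_geomKernel {ρ : ℝ} (h0 : 0 < ρ) (h1 : ρ < 1) :
    ∫ t in (0 : ℝ)..1, (1 - ρ * t)⁻¹ = -Real.log (1 - ρ) / ρ := by
  have hpos : ∀ t ∈ Set.uIcc (0 : ℝ) 1, 0 < 1 - ρ * t := fun t ht => by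
    rw [Set.uIcc_of_le zero_le_one] at ht
    nlinarith [ht.1, ht.2]
  have hd : ∀ t ∈ Set.uIcc (0 : ℝ) 1,
      HasDerivAt (fun t => -Real.log (1 - ρ * t) / ρ) (1 - ρ * t)⁻¹ t := fun t ht => by
    have h2 : HasDerivAt (fun t : ℝ => 1 - ρ * t) (-(ρ * 1)) t :=
      ((hasDerivAt_id t).const_mul ρ).const_sub 1
    have h3 := ((h2.log (hpos t ht).ne').neg).div_const ρ
    refine h3.congr_deriv ?_
    have := (hpos t ht).ne'
    field_simp
  rw [intervalIntegral.integral_eq_sub_of_hasDerivAt hd]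
  · simp
  · refine ContinuousOn.intervalIntegrable (ContinuousOn.inv₀ (by fun_prop) fun t ht => ?_)
    exact (hpos t ht).ne'

/-- The mean of the Poisson kernel. -/
theorem integral_circle_geomKernelDeriv {ρ r : ℝ} (h0 : 0 < ρ) (h1 : ρ < 1) (hr0 : 0 < r)
    (hr1 : r < 1) :
    ∫ θ in (0 : ℝ)..2 * π, ‖geomKernelDeriv ρ (circleMap 0 r θ)‖ =
      2 * π * (ρ / (1 - (ρ * r) ^ 2)) := by
  have hs0 : 0 < ρ * r := by positivity
  have hs1 : ρ * r < 1 := by nlinarith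
  -- As `|1 - ρ r e^{iθ}| = |e^{iθ} - ρ r|`, the modulus of the derivative is `ρ / (1 - (ρr)^2)`
  -- times the Poisson kernel at the point `ρ r`, whose average against the constant `1` is `1`.
  have hP := DiffContOnCl.circleAverage_poissonKernel_smul' (E := ℂ) (f := fun _ => 1) (c := 0)
    (R := 1) (w := ((ρ * r : ℝ) : ℂ)) diffContOnCl_const
    (by rw [mem_ball_zero_iff, Complex.norm_real, Real.norm_of_nonneg hs0.le]; exact hs1)
  have h2 : 0 < 1 - (ρ * r) ^ 2 := by nlinarith
  have e : ∀ θ : ℝ, ((‖circleMap 0 1 θ - 0‖ ^ 2 - ‖((ρ * r : ℝ) : ℂ) - 0‖ ^ 2) /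
      ‖circleMap 0 1 θ - 0 - (((ρ * r : ℝ) : ℂ) - 0)‖ ^ 2) • (1 : ℂ) =
      (((1 - (ρ * r) ^ 2) / ρ * ‖geomKernelDeriv ρ (circleMap 0 r θ)‖ : ℝ) : ℂ) := fun θ => by
    have hn : ‖circleMap 0 1 θ - ((ρ * r : ℝ) : ℂ)‖ = ‖1 - (ρ : ℂ) * circleMap 0 r θ‖ := by
      rw [← sq_eq_sq₀ (norm_nonneg _) (norm_nonneg _), Complex.sq_norm, Complex.sq_norm]
      simp only [circleMap, zero_add, Complex.normSq_apply, Complex.sub_re, Complex.sub_im,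
        Complex.mul_re, Complex.mul_im, Complex.ofReal_re, Complex.ofReal_im,
        Complex.exp_ofReal_mul_I_re, Complex.exp_ofReal_mul_I_im, Complex.one_re, Complex.one_im]
      have := Real.sin_sq_add_cos_sq θ
      linear_combination (1 - (ρ * r) ^ 2) * this
    rw [sub_zero, sub_zero, hn, geomKernelDeriv, norm_div, norm_pow, Complex.norm_real,
      Complex.norm_real, Real.norm_of_nonneg h0.le, Real.norm_of_nonneg hs0.le,
      norm_circleMap_zero, abs_one, one_pow, Complex.real_smul, mul_one]
    congr 1
    field_simp
  rw [Real.circleAverage_def] at hP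
  simp_rw [e] at hP
  rw [intervalIntegral.integral_ofReal, Complex.real_smul,
    intervalIntegral.integral_const_mul] at hP
  have hP' : (2 * π)⁻¹ * ((1 - (ρ * r) ^ 2) / ρ *
      ∫ θ in (0 : ℝ)..2 * π, ‖geomKernelDeriv ρ (circleMap 0 r θ)‖) = 1 := by exact_mod_cast hP
  have hpi := Real.pi_pos
  rw [mul_div_assoc', eq_div_iff h2.ne']
  field_simp at hP'
  linear_combination hP'

theorem differentiableOn_geomKernelDeriv {ρ : ℝ} (h0 : 0 ≤ ρ) (h1 : ρ ≤ 1) :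
    DifferentiableOn ℂ (geomKernelDeriv ρ) (Metric.ball 0 1) := by
  unfold geomKernelDeriv
  intro z hz
  refine DifferentiableWithinAt.div (by fun_prop) (by fun_prop) (pow_ne_zero 2 ?_)
  exact one_sub_ne_zero h0 h1 hz

/-- The unweighted area integral of the derivative of `1 / (1 - ρ z)`. -/
theorem lintegral_geomKernelDeriv_le {ρ : ℝ} (h0 : 0 < ρ) (h1 : ρ < 1) :
    ∫⁻ z, ENNReal.ofReal ‖geomKernelDeriv ρ z‖ ∂area ≤ ENNReal.ofReal (2 * -Real.log (1 - ρ)) := by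
  have hpi := Real.pi_pos
  have hpos : ∀ r ∈ Set.Icc (0 : ℝ) 1, 0 < 1 - ρ * r := fun r hr => by nlinarith [hr.1, hr.2]
  have hm := measurable_geomKernelDeriv ρ
  have hle : ∫⁻ z in Metric.ball (0 : ℂ) 1, ENNReal.ofReal ‖geomKernelDeriv ρ z‖ ≤
      ENNReal.ofReal (∫ r in (0 : ℝ)..1, 2 * π * ρ * (1 - ρ * r)⁻¹) := by
    rw [lintegral_ball_polar (F := fun z => ENNReal.ofReal ‖geomKernelDeriv ρ z‖) (by fun_prop),
      intervalIntegral.integral_of_le zero_le_one, ← restrict_Ioo_eq_restrict_Ioc,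
      ofReal_integral_eq_lintegral_ofReal]
    · refine setLIntegral_mono' measurableSet_Ioo fun r hr => ?_
      rw [lintegral_circle_eq (differentiableOn_geomKernelDeriv h0.le h1.le).continuousOn hr.1 hr.2,
        integral_circle_geomKernelDeriv h0 h1 hr.1 hr.2, ← ENNReal.ofReal_mul hr.1.le]
      apply ENNReal.ofReal_le_ofReal
      have h2 := hpos r ⟨hr.1.le, hr.2.le⟩
      have hr0 := hr.1
      -- Replacing `(ρr)^2` by `ρr` and the Jacobian by `1` leaves the integrand of
      -- `integral_geomKernel`.
      have h3 : 1 - ρ * r ≤ 1 - (ρ * r) ^ 2 := by nlinarith [mul_pos h0 hr.1]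
      calc r * (2 * π * (ρ / (1 - (ρ * r) ^ 2))) ≤ 1 * (2 * π * (ρ / (1 - ρ * r))) := by
            have := hr.2.le
            have h4 : 0 < 1 - (ρ * r) ^ 2 := by linarith
            gcongr
        _ = _ := by ring
    · refine (ContinuousOn.integrableOn_Icc ?_).mono_set Set.Ioo_subset_Icc_self
      exact continuousOn_const.mul (ContinuousOn.inv₀ (by fun_prop) fun r hr => (hpos r hr).ne')
    · refine (ae_restrict_iff' measurableSet_Ioo).2 (Filter.Eventually.of_forall fun r hr => ?_)
      have h2 := hpos r ⟨hr.1.le, hr.2.le⟩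
      change 0 ≤ 2 * π * ρ * (1 - ρ * r)⁻¹
      positivity
  rw [intervalIntegral.integral_const_mul, integral_geomKernel h0 h1] at hle
  rw [area, lintegral_smul_measure, smul_eq_mul, mul_comm, ← div_eq_mul_inv]
  refine ENNReal.div_le_of_le_mul (hle.trans_eq ?_)
  rw [← ENNReal.ofReal_mul' hpi.le]
  congr 1
  field_simp

theorem area_univ : area Set.univ = 1 := by
  rw [area, Measure.smul_apply, Measure.restrict_apply_univ, Complex.volume_ball, smul_eq_mul]
  have : (NNReal.pi : ENNReal) = ENNReal.ofReal π := by
    rw [ENNReal.ofReal, ← NNReal.coe_real_pi, Real.toNNReal_coe]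
  rw [this]
  simp [ENNReal.inv_mul_cancel, Real.pi_pos]

/-! ### Negative exponents: kernels of small seminorm -/

theorem weight_le {α : ℝ} (hα : α ≤ 0) {z : ℂ} (hz : z ∈ Metric.ball (0 : ℂ) 1) :
    weight α z ≤ Real.log 2 ^ α := by
  have hl : 0 < Real.log 2 := Real.log_pos (by norm_num)
  have hz1 : ‖z‖ < 1 := by simpa using hz
  refine Real.rpow_le_rpow_of_nonpos hl (Real.log_le_log (by norm_num) ?_) hα
  rw [le_div_iff₀ (by linarith)]
  linarith [norm_nonneg z]

/-- For negative exponents the weight vanishes at the boundary. -/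
theorem exists_weight_le {α : ℝ} (hα : α < 0) {ε : ℝ} (hε : 0 < ε) :
    ∃ R < 1, ∀ z ∈ Metric.ball (0 : ℂ) 1, R < ‖z‖ → weight α z ≤ ε := by
  have hlim : Filter.Tendsto (fun x : ℝ => x ^ α) Filter.atTop (nhds 0) := by
    simpa using tendsto_rpow_neg_atTop (neg_pos.2 hα)
  obtain ⟨A, hA⟩ := Filter.eventually_atTop.1 (hlim.eventually (ge_mem_nhds hε))
  refine ⟨1 - Real.exp (-A), by linarith [Real.exp_pos (-A)], fun z hz hR => hA _ ?_⟩
  have hz1 : ‖z‖ < 1 := by simpa using hz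
  rw [Real.le_log_iff_exp_le (div_pos two_pos (by linarith)), le_div_iff₀ (by linarith)]
  have h2 : 1 - ‖z‖ ≤ Real.exp (-A) := by linarith
  calc Real.exp A * (1 - ‖z‖) ≤ Real.exp A * Real.exp (-A) := by gcongr
    _ = 1 := by rw [← Real.exp_add]; simp
    _ ≤ 2 := by norm_num

/-- For negative exponents the functions `1 / (1 - ρ z)` have small weighted seminorm in comparison
with `log (1 / (1 - ρ))`. -/
theorem exists_lintegral_geomKernelDeriv_le {α : ℝ} (hα : α < 0) {ε : ℝ} (hε : 0 < ε) :
    ∃ ρ : ℝ, 0 < ρ ∧ ρ < 1 ∧ 1 ≤ ε * -Real.log (1 - ρ) ∧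
      ∫⁻ z, ENNReal.ofReal (‖geomKernelDeriv ρ z‖ * weight α z) ∂area ≤
        ENNReal.ofReal (ε * -Real.log (1 - ρ)) := by
  obtain ⟨R, hR1, hR⟩ := exists_weight_le hα (show 0 < ε / 4 by positivity)
  have hl : 0 < Real.log 2 := Real.log_pos (by norm_num)
  -- `C` bounds the integrand on `|z| ≤ R` for every `ρ`; outside, the weight is at most `ε/4`. The
  -- total is at most `C + (ε/4)(2L)`, which `L ≥ 2C/ε` brings below `ε L`. Taking `ρ = 1 - e^{-L}`
  -- makes `log (1/(1-ρ)) = L`.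
  set C : ℝ := ((1 - R) ^ 2)⁻¹ * Real.log 2 ^ α with hC
  have h1R : 0 < 1 - R := by linarith
  have hC0 : 0 < C := by positivity
  set L : ℝ := max (1 / ε) (2 * C / ε) with hL
  have hL0 : 0 < L := lt_of_lt_of_le (by positivity) (le_max_left _ _)
  have hL1 : 1 ≤ ε * L := by
    have := le_max_left (1 / ε) (2 * C / ε)
    rw [div_le_iff₀ hε] at this
    linarith
  have hL2 : 2 * C ≤ ε * L := by
    have := le_max_right (1 / ε) (2 * C / ε)
    rw [div_le_iff₀ hε] at this
    linarith
  have hlog : -Real.log (1 - (1 - Real.exp (-L))) = L := by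
    rw [sub_sub_cancel, Real.log_exp, neg_neg]
  have hexp : Real.exp (-L) < 1 := by rw [Real.exp_lt_one_iff]; linarith
  have hρ0 : 0 < 1 - Real.exp (-L) := by linarith
  have hρ1 : 1 - Real.exp (-L) < 1 := by linarith [Real.exp_pos (-L)]
  refine ⟨1 - Real.exp (-L), hρ0, hρ1, by rwa [hlog], ?_⟩
  have hk := lintegral_geomKernelDeriv_le hρ0 hρ1
  rw [hlog] at hk ⊢
  set ρ := 1 - Real.exp (-L)
  have hm := measurable_geomKernelDeriv ρ
  calc ∫⁻ z, ENNReal.ofReal (‖geomKernelDeriv ρ z‖ * weight α z) ∂area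
      ≤ ∫⁻ z, (ENNReal.ofReal C +
          ENNReal.ofReal (ε / 4) * ENNReal.ofReal ‖geomKernelDeriv ρ z‖) ∂area := by
        refine lintegral_mono_ae ?_
        filter_upwards [ae_area] with z hz
        rw [← ENNReal.ofReal_mul (by positivity), ← ENNReal.ofReal_add hC0.le (by positivity)]
        apply ENNReal.ofReal_le_ofReal
        have hw := weight_pos α hz
        rcases le_or_gt ‖z‖ R with h | h
        · have h2 := norm_geomKernelDeriv_le hρ0.le hρ1.le hR1 h
          have h3 := weight_le hα.le hz
          have h4 : ‖geomKernelDeriv ρ z‖ * weight α z ≤ C := by rw [hC]; gcongr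
          have h5 : 0 ≤ ε / 4 * ‖geomKernelDeriv ρ z‖ := by positivity
          linarith
        · have h2 := mul_le_mul_of_nonneg_left (hR z hz h) (norm_nonneg (geomKernelDeriv ρ z))
          linarith
    _ = ENNReal.ofReal C + ENNReal.ofReal (ε / 4) *
          ∫⁻ z, ENNReal.ofReal ‖geomKernelDeriv ρ z‖ ∂area := by
        rw [lintegral_add_left measurable_const, lintegral_const, area_univ, mul_one,
          lintegral_const_mul _ (by fun_prop)]
    _ ≤ ENNReal.ofReal C + ENNReal.ofReal (ε / 4) * ENNReal.ofReal (2 * L) := by gcongr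
    _ = ENNReal.ofReal (C + ε / 4 * (2 * L)) := by
        rw [ENNReal.ofReal_add hC0.le (by positivity),
          ENNReal.ofReal_mul (show 0 ≤ ε / 4 by positivity)]
    _ ≤ _ := ENNReal.ofReal_le_ofReal (by linarith)

/-! ### No continuous extension of the Libera operator -/

theorem mem_ball_of_mem_Ioo {t : ℝ} (ht : t ∈ Set.Ioo (0 : ℝ) 1) :
    (t : ℂ) ∈ Metric.ball (0 : ℂ) 1 := by
  rw [mem_ball_zero_iff, Complex.norm_real, Real.norm_of_nonneg ht.1.le]
  exact ht.2

theorem mem_blochOne_of_lintegral {α : ℝ} {f : Hol}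
    (h : ∫⁻ z, ENNReal.ofReal (‖der f z‖ * weight α z) ∂area ≠ ⊤) : f ∈ blochOne α :=
  ⟨(measurable_integrand α f).aestronglyMeasurable,
    (hasFiniteIntegral_iff_ofReal (integrand_nonneg α f)).2 h.lt_top⟩

theorem differentiableOn_geomKernel {ρ : ℝ} (h0 : 0 ≤ ρ) (h1 : ρ ≤ 1) :
    DifferentiableOn ℂ (geomKernel ρ) (Metric.ball 0 1) := fun _ hz =>
  (hasDerivAt_geomKernel (one_sub_ne_zero h0 h1 hz)).differentiableAt.differentiableWithinAt

/-- The only pole, `1/ρ`, lies outside the closed disk. -/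
theorem holOf_geomKernel_mem_holClosed {ρ : ℝ} (h0 : 0 < ρ) (h1 : ρ < 1) :
    holOf (geomKernel ρ) (differentiableOn_geomKernel h0.le h1.le) ∈ holClosed := by
  refine ⟨geomKernel ρ, fun z hz => ?_, fun _ => rfl⟩
  have hz1 : ‖z‖ ≤ 1 := by simpa using hz
  have hne : 1 - (ρ : ℂ) * z ≠ 0 := by
    rw [← norm_pos_iff]
    nlinarith [le_norm_one_sub h0.le z]
  exact AnalyticAt.inv (by fun_prop) hne

theorem libera_geomKernel {ρ : ℝ} (h0 : 0 < ρ) (h1 : ρ < 1) :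
    libera (holOf (geomKernel ρ) (differentiableOn_geomKernel h0.le h1.le)) ⟨0, by simp⟩ =
      ((-Real.log (1 - ρ) / ρ : ℝ) : ℂ) := by
  rw [libera, ← integral_geomKernel h0 h1, ← intervalIntegral.integral_ofReal,
    intervalIntegral.integral_of_le zero_le_one, intervalIntegral.integral_of_le zero_le_one,
    -- The endpoint `t = 1` is removed because `fn` is zero outside the open disk.
    ← restrict_Ioo_eq_restrict_Ioc]
  refine setIntegral_congr_fun measurableSet_Ioo fun t ht => ?_
  simp only [mul_zero, add_zero]
  rw [fn_holOf _ (mem_ball_of_mem_Ioo ht), geomKernel]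
  push_cast
  rfl

/-- For negative exponents the Libera operator has no continuous extension. -/
theorem not_exists_libera_extension {α : ℝ} (hα : α < 0) :
    ¬ ∃ T : BlochOne α →L[ℂ] Hol, ∀ f : BlochOne α, f.toHol ∈ holClosed →
      ∀ z : Disk, (T f).1 z = libera f.toHol z := by
  rintro ⟨T, hT⟩
  set S : BlochOne α →L[ℂ] ℂ :=
    ((ContinuousMap.evalCLM ℂ (⟨0, by simp⟩ : Disk)).comp Hol.subtypeL).comp T with hS
  -- Chosen so that `‖S‖ · 2εℓ = ℓ - εℓ < ℓ`, against `|S f| = ℓ/ρ ≥ ℓ`.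
  set ε : ℝ := 1 / (2 * ‖S‖ + 1) with hε
  have hS0 := norm_nonneg S
  have hε0 : 0 < ε := by positivity
  obtain ⟨ρ, h0, h1, hlog, hint⟩ := exists_lintegral_geomKernelDeriv_le hα hε0
  set ℓ : ℝ := -Real.log (1 - ρ) with hℓ
  have hd := differentiableOn_geomKernel h0.le h1.le
  have hae : ∀ᵐ z ∂area, ‖der (holOf (geomKernel ρ) hd) z‖ * weight α z =
      ‖geomKernelDeriv ρ z‖ * weight α z := by
    filter_upwards [ae_area] with z hz
    rw [der_holOf hd hz, (hasDerivAt_geomKernel (one_sub_ne_zero h0.le h1.le hz)).deriv]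
  have hint' : ∫⁻ z, ENNReal.ofReal (‖der (holOf (geomKernel ρ) hd) z‖ * weight α z) ∂area ≤
      ENNReal.ofReal (ε * ℓ) := by
    refine le_trans (le_of_eq (lintegral_congr_ae ?_)) hint
    filter_upwards [hae] with z hz
    rw [hz]
  have hmem : holOf (geomKernel ρ) hd ∈ blochOne α :=
    mem_blochOne_of_lintegral (ne_top_of_le_ne_top ENNReal.ofReal_ne_top hint')
  let f : BlochOne α := (⟨holOf (geomKernel ρ) hd, hmem⟩ : blochOne α)
  have hf : f.toHol = holOf (geomKernel ρ) hd := rfl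
  have hnorm : ‖f‖ ≤ 1 + ε * ℓ := by
    rw [BlochOne.norm_def, hf, fn_holOf hd (by simp)]
    refine add_le_add (by simp [geomKernel]) ?_
    rw [integral_eq_lintegral_of_nonneg_ae (integrand_nonneg α _)
      (measurable_integrand α _).aestronglyMeasurable]
    exact ENNReal.toReal_le_of_le_ofReal (by linarith) hint'
  have hSf : S f = ((ℓ / ρ : ℝ) : ℂ) := by
    rw [← libera_geomKernel h0 h1]
    exact hT f (holOf_geomKernel_mem_holClosed h0 h1) _
  have hℓ0 : 0 < ℓ := by
    by_contra! h
    nlinarith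
  have hle := S.le_opNorm f
  rw [hSf, Complex.norm_real, Real.norm_of_nonneg (by positivity)] at hle
  have h2 : ℓ ≤ ℓ / ρ := by
    rw [le_div_iff₀ h0]
    nlinarith
  -- The term `|f(0)| = 1` of the norm is absorbed by `1 ≤ εℓ`.
  have h3 : ‖S‖ * ‖f‖ ≤ ‖S‖ * (2 * (ε * ℓ)) := by
    gcongr
    linarith
  have h4 : ε * (2 * ‖S‖ + 1) = 1 := by
    rw [hε]
    field_simp
  have h5 : 0 < ε * ℓ := by positivity
  have h6 : ℓ = ε * ℓ * (2 * ‖S‖) + ε * ℓ := by linear_combination -ℓ * h4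
  linarith

/-! ### Failure of the inclusion for negative exponents -/

/-- The Taylor series of a function in `ℓ¹₋₁` is absolutely integrable on the unit interval. -/
theorem lintegral_fn_lt_top {f : Hol} (hf : f ∈ ellOne) :
    ∫⁻ t in Set.Ioo (0 : ℝ) 1, ENNReal.ofReal ‖fn f t‖ < ⊤ := by
  have hsum : Summable fun n : ℕ => ‖coeff f n‖ / ((n : ℝ) + 1) := hf
  have hd : DifferentiableOn ℂ (fn f) (Metric.ball 0 1) :=
    (f.2 : DifferentiableOn ℂ (extend _) _)
  have hle : ∫⁻ t in Set.Ioo (0 : ℝ) 1, ENNReal.ofReal ‖fn f t‖ ≤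
      ∫⁻ t in Set.Ioo (0 : ℝ) 1, ∑' n : ℕ, ENNReal.ofReal (‖coeff f n‖ * t ^ n) := by
    refine setLIntegral_mono' measurableSet_Ioo fun t ht => ?_
    have hs := Complex.hasSum_taylorSeries_on_ball hd (mem_ball_of_mem_Ioo ht)
    rw [← hs.tsum_eq, ofReal_norm]
    refine enorm_tsum_le_tsum_enorm.trans (le_of_eq (tsum_congr fun n => ?_))
    rw [← ofReal_norm, coeff, norm_smul, norm_smul, norm_inv, sub_zero, norm_pow,
      Complex.norm_real, Real.norm_of_nonneg ht.1.le, norm_div]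
    congr 1
    ring
  refine hle.trans_lt ?_
  -- By Tonelli and `∫ t^n = 1/(n+1)`, the bound is exactly the sum defining `ellOne`.
  rw [lintegral_tsum fun n => by fun_prop]
  have hterm : ∀ n : ℕ, ∫⁻ t in Set.Ioo (0 : ℝ) 1, ENNReal.ofReal (‖coeff f n‖ * t ^ n) =
      ENNReal.ofReal (‖coeff f n‖ / ((n : ℝ) + 1)) := fun n => by
    rw [← ofReal_integral_eq_lintegral_ofReal, restrict_Ioo_eq_restrict_Ioc,
      ← intervalIntegral.integral_of_le zero_le_one, intervalIntegral.integral_const_mul,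
      integral_pow]
    · simp [div_eq_mul_inv]
    · exact (Continuous.integrableOn_Icc (by fun_prop)).mono_set Set.Ioo_subset_Icc_self
    · refine (ae_restrict_iff' measurableSet_Ioo).2 (Filter.Eventually.of_forall fun t ht => ?_)
      have := ht.1
      change 0 ≤ ‖coeff f n‖ * t ^ n
      positivity
  simp_rw [hterm]
  exact hsum.tsum_ofReal_lt_top

/-- For negative exponents a lacunary superposition of the functions `1 / (1 - ρ z)` lies in
`𝔅¹_{log^α}` but not in `ℓ¹₋₁`. -/
theorem not_blochOne_subset_ellOne {α : ℝ} (hα : α < 0) :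
    ¬ (blochOne α : Set Hol) ⊆ ellOne := by
  intro hsub
  choose ρ h0 h1 hlog hint using fun k : ℕ =>
    exists_lintegral_geomKernelDeriv_le hα (show (0 : ℝ) < (1 / 2) ^ k by positivity)
  set ℓ : ℕ → ℝ := fun k => -Real.log (1 - ρ k) with hℓ
  have hℓ0 : ∀ k, 0 < ℓ k := fun k => by
    by_contra! h
    have := hlog k
    have h2 : (0 : ℝ) < (1 / 2) ^ k := by positivity
    change 1 ≤ (1 / 2) ^ k * ℓ k at this
    nlinarith
  -- With this scaling the `k`-th term has weighted seminorm at most `2^{-k}` but integral at least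
  -- `1` over `[0,1]`.
  set c : ℕ → ℝ := fun k => (ℓ k)⁻¹ with hc
  have hc0 : ∀ k, 0 < c k := fun k => inv_pos.2 (hℓ0 k)
  have hcle : ∀ k, c k ≤ (1 / 2) ^ k := fun k => by
    rw [hc, inv_le_iff_one_le_mul₀ (hℓ0 k)]
    exact hlog k
  have hcs : Summable c := Summable.of_nonneg_of_le (fun k => (hc0 k).le) hcle
    (summable_geometric_of_lt_one (by norm_num) (by norm_num))
  set g : ℂ → ℂ := fun z => ∑' k, (c k : ℂ) * geomKernel (ρ k) z with hg
  have hderiv : ∀ z ∈ Metric.ball (0 : ℂ) 1,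
      HasDerivAt g (∑' k, (c k : ℂ) * geomKernelDeriv (ρ k) z) z := by
    intro z hz
    have hz1 : ‖z‖ < 1 := by simpa using hz
    -- On `|y| < R` the differentiated terms are at most `c k / (1-R)^2`, so the series may be
    -- differentiated termwise.
    obtain ⟨R, hzR, hR1⟩ := exists_between hz1
    have hsubset : Metric.ball (0 : ℂ) R ⊆ Metric.ball 0 1 := Metric.ball_subset_ball hR1.le
    refine hasDerivAt_tsum_of_isPreconnected (hcs.mul_right ((1 - R) ^ 2)⁻¹)
      (t := Metric.ball 0 R) Metric.isOpen_ball (convex_ball _ _).isPreconnected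
      (fun k y hy => (hasDerivAt_geomKernel
        (one_sub_ne_zero (h0 k).le (h1 k).le (hsubset hy))).const_mul _)
      (fun k y hy => ?_) (y₀ := 0) (Metric.mem_ball_self ((norm_nonneg z).trans_lt hzR)) ?_
      (by simpa using hzR)
    · rw [norm_mul, Complex.norm_real, Real.norm_of_nonneg (hc0 k).le]
      have hyR : ‖y‖ < R := by simpa using hy
      exact mul_le_mul_of_nonneg_left
        (norm_geomKernelDeriv_le (h0 k).le (h1 k).le hR1 hyR.le) (hc0 k).le
    · simp only [geomKernel, mul_zero, sub_zero, inv_one, mul_one]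
      exact_mod_cast hcs
  have hgd : DifferentiableOn ℂ g (Metric.ball 0 1) := fun z hz =>
    (hderiv z hz).differentiableAt.differentiableWithinAt
  have hmem : holOf g hgd ∈ blochOne α := by
    apply mem_blochOne_of_lintegral
    have hle : ∫⁻ z, ENNReal.ofReal (‖der (holOf g hgd) z‖ * weight α z) ∂area ≤
        ∫⁻ z, ∑' k, ENNReal.ofReal (c k) *
          ENNReal.ofReal (‖geomKernelDeriv (ρ k) z‖ * weight α z) ∂area := by
      refine lintegral_mono_ae ?_
      filter_upwards [ae_area] with z hz
      have hw := (weight_pos α hz).le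
      rw [der_holOf hgd hz, (hderiv z hz).deriv, ENNReal.ofReal_mul (norm_nonneg _),
        ofReal_norm]
      refine (mul_le_mul_left enorm_tsum_le_tsum_enorm _).trans ?_
      rw [← ENNReal.tsum_mul_right]
      refine le_of_eq (tsum_congr fun k => ?_)
      rw [ENNReal.ofReal_mul (norm_nonneg _), ← mul_assoc, ← ENNReal.ofReal_mul (hc0 k).le,
        ← ofReal_norm, norm_mul, Complex.norm_real, Real.norm_of_nonneg (hc0 k).le]
    have hmw : Measurable (weight α) := by
      unfold weight
      fun_prop
    have hm : ∀ k, Measurable fun z =>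
        ENNReal.ofReal (‖geomKernelDeriv (ρ k) z‖ * weight α z) := fun k =>
      ((measurable_geomKernelDeriv (ρ k)).norm.mul hmw).ennreal_ofReal
    rw [lintegral_tsum fun k => ((hm k).const_mul _).aemeasurable] at hle
    refine ne_top_of_le_ne_top ?_ (hle.trans (ENNReal.tsum_le_tsum (g := fun k =>
      ENNReal.ofReal ((1 / 2) ^ k)) fun k => ?_))
    · exact (summable_geometric_of_lt_one (by norm_num) (by norm_num)).tsum_ofReal_ne_top
    · rw [lintegral_const_mul _ (hm k)]
      calc _ ≤ ENNReal.ofReal (c k) * ENNReal.ofReal ((1 / 2) ^ k * ℓ k) := by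
            gcongr
            exact hint k
        _ = ENNReal.ofReal ((1 / 2) ^ k) := by
            rw [← ENNReal.ofReal_mul (hc0 k).le, mul_left_comm,
              inv_mul_cancel₀ (hℓ0 k).ne', mul_one]
  have hfin := lintegral_fn_lt_top (hsub hmem)
  obtain ⟨K, hK⟩ := ENNReal.exists_nat_gt hfin.ne
  refine hK.not_ge ?_
  have hpos : ∀ k, ∀ t ∈ Set.Icc (0 : ℝ) 1, 0 < 1 - ρ k * t := fun k t ht => by
    nlinarith [ht.1, ht.2, h0 k, h1 k]
  have hcont : ∀ k, ContinuousOn (fun t : ℝ => c k * (1 - ρ k * t)⁻¹) (Set.Icc 0 1) := fun k =>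
    continuousOn_const.mul (ContinuousOn.inv₀ (by fun_prop) fun t ht => (hpos k t ht).ne')
  have hlow : (K : ℝ) ≤ ∫ t in (0 : ℝ)..1, ∑ k ∈ Finset.range K, c k * (1 - ρ k * t)⁻¹ := by
    rw [intervalIntegral.integral_finsetSum fun k _ => ContinuousOn.intervalIntegrable
      (by rw [Set.uIcc_of_le zero_le_one]; exact hcont k)]
    have : ∀ k ∈ Finset.range K, (1 : ℝ) ≤ ∫ t in (0 : ℝ)..1, c k * (1 - ρ k * t)⁻¹ :=
      fun k _ => by
        rw [intervalIntegral.integral_const_mul, integral_geomKernel (h0 k) (h1 k)]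
        change 1 ≤ (ℓ k)⁻¹ * (ℓ k / ρ k)
        rw [← mul_div_assoc, inv_mul_cancel₀ (hℓ0 k).ne', one_le_div (h0 k)]
        exact (h1 k).le
    simpa using Finset.card_nsmul_le_sum _ _ _ this
  calc (K : ENNReal) = ENNReal.ofReal K := by simp
    _ ≤ ENNReal.ofReal (∫ t in (0 : ℝ)..1, ∑ k ∈ Finset.range K, c k * (1 - ρ k * t)⁻¹) :=
        ENNReal.ofReal_le_ofReal hlow
    _ = ∫⁻ t in Set.Ioo (0 : ℝ) 1,
          ENNReal.ofReal (∑ k ∈ Finset.range K, c k * (1 - ρ k * t)⁻¹) := by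
        rw [intervalIntegral.integral_of_le zero_le_one, ← restrict_Ioo_eq_restrict_Ioc,
          ofReal_integral_eq_lintegral_ofReal]
        · refine (ContinuousOn.integrableOn_Icc ?_).mono_set Set.Ioo_subset_Icc_self
          exact continuousOn_finsetSum _ fun k _ => hcont k
        · refine (ae_restrict_iff' measurableSet_Ioo).2 (Filter.Eventually.of_forall fun t ht => ?_)
          exact Finset.sum_nonneg fun k _ => mul_nonneg (hc0 k).le
            (inv_nonneg.2 (hpos k t ⟨ht.1.le, ht.2.le⟩).le)
    _ ≤ _ := by
        -- On the real segment all terms are nonnegative, so nothing cancels and `|g(t)|` dominates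
        -- every partial sum.
        refine setLIntegral_mono' measurableSet_Ioo fun t ht => ENNReal.ofReal_le_ofReal ?_
        have hp : ∀ k, 0 ≤ c k * (1 - ρ k * t)⁻¹ := fun k => mul_nonneg (hc0 k).le
          (inv_nonneg.2 (hpos k t ⟨ht.1.le, ht.2.le⟩).le)
        have hs : Summable fun k => c k * (1 - ρ k * t)⁻¹ := by
          refine Summable.of_nonneg_of_le hp (fun k => ?_) (hcs.mul_right (1 - t)⁻¹)
          have h2 : 0 < 1 - t := by linarith [ht.2]
          have h3 : 1 - t ≤ 1 - ρ k * t := by nlinarith [ht.1, h1 k]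
          have := (hc0 k).le
          gcongr
        have hval : fn (holOf g hgd) t = ((∑' k, c k * (1 - ρ k * t)⁻¹ : ℝ) : ℂ) := by
          rw [fn_holOf hgd (mem_ball_of_mem_Ioo ht), Complex.ofReal_tsum]
          refine tsum_congr fun k => ?_
          rw [geomKernel]
          push_cast
          rfl
        rw [hval, Complex.norm_real, Real.norm_of_nonneg (tsum_nonneg hp)]
        exact hs.sum_le_tsum _ fun k _ => hp k

end LogBloch

theorem mainTheorem5 (α : ℝ) :
    LogBloch.bloch α ⊆ LogBloch.ellOne ∧
    ((LogBloch.blochOne α : Set LogBloch.Hol) ⊆ LogBloch.ellOne ↔ 0 ≤ α) ∧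
    (α < 0 → ¬ ∃ T : LogBloch.BlochOne α →L[ℂ] LogBloch.Hol,
      ∀ f : LogBloch.BlochOne α, f.toHol ∈ LogBloch.holClosed →
        ∀ z : LogBloch.Disk, (T f).1 z = LogBloch.libera f.toHol z) :=
  ⟨LogBloch.bloch_subset_ellOne α,
    ⟨fun h => not_lt.1 fun hα => LogBloch.not_blochOne_subset_ellOne hα h,
      LogBloch.blochOne_subset_ellOne⟩,
    LogBloch.not_exists_libera_extension⟩
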